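/- For $a \ge 1$ and $s \in \mathbb{R}$ let $$\gamma = \frac{|\Gamma(a - is/2)|^2}{\Gamma(a)\,\Gamma(a-1/2)\,\Gamma(1/2)}, \qquad h(y) = \begin{cases}\gamma\, e^{sy} (\cos^2 y)^{a-1}, & |y| \le \pi/2,\\ 0, & \text{otherwise}\end{cases}$$ (with $0^0 = 1$); $h$ is the density of $\arctan X$ when $X$ has the Pearson IV density $\gamma e^{s \arctan x} (1+x^2)^{-a}$ on $\mathbb{R}$. For $a > 1$ put $$\beta = \frac{s}{2(a-1)}, \qquad m = \arctan \beta, \qquad \tau = \sqrt{(a-1)(1+\beta^2)};$$ for $a = 1$ let $m$ be the limit of $\arctan(s/(2(a-1)))$ as $a \downarrow 1$, that is, $m = \pi/2$, $0$, $-\pi/2$ according to $s > 0$, $s = 0$, $s < 0$, and, when $s = 0$, let $\tau = 0$. Consider the following rejection algorithm. - If $\tau \ge \sqrt{2/\pi}$: repeat: draw a standard Gaussian $N$ and, independently, $U$ uniform on $[0,1]$, and set $Y = m + N/\tau$; until $U\, h(m)\, e^{-\tau^2 (Y-m)^2/2} \le h(Y)$. - If $\tau < \sqrt{2/\pi}$: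 repeat: draw $Y$ uniform on $[-\pi/2, \pi/2]$ and, independently, $U$ uniform on $[0,1]$; until $U \le h(Y)/h(m)$. - Return $\tan Y$. The draws of different iterations are independent. Lemma. For all $a \ge 1$ and $s \in \mathbb{R}$ such that $|m| \le \arctan\left(\frac{3}{4\pi}\right)$: 1. $h(y) \le h(m)\, e^{-\tau^2 (y-m)^2/2}$ for all $y \in \mathbb{R}$; 2. the expected number of iterations taken by the algorithm is at most $\sqrt{2\pi + \pi^2}$. Here $\sqrt{2\pi+\pi^2} \approx 4.02$, correct to two decimals. -/

import Mathlib

open MeasureTheory ProbabilityTheory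
open scoped ENNReal

noncomputable section

namespace PearsonIV

/-- The normalization constant
`γ = |Γ(a - i s / 2)|² / (Γ(a) Γ(a - 1/2) Γ(1/2))` of the Pearson IV density. -/
def normConst (a s : ℝ) : ℝ :=
  ‖Complex.Gamma ((a : ℂ) - Complex.I * (s : ℂ) / 2)‖ ^ 2 /
    (Real.Gamma a * Real.Gamma (a - 1 / 2) * Real.Gamma (1 / 2))

/-- The arctan-mapped Pearson IV density: `h(y) = γ e^{s y} (cos² y)^{a-1}` for `|y| ≤ π/2`, and
`h(y) = 0` elsewhere. -/
def density (a s y : ℝ) : ℝ :=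
  if |y| ≤ Real.pi / 2 then
    normConst a s * Real.exp (s * y) * (Real.cos y ^ 2) ^ (a - 1)
  else 0

/-- `β = s / (2 (a - 1))`; meaningful for `a ≠ 1`. -/
def beta (a s : ℝ) : ℝ := s / (2 * (a - 1))

/-- The mode `m = arctan β`. For `a = 1` it is read as the limit of `arctan (s / (2 (a - 1)))` as
`a` decreases to `1`: `π/2` for `s > 0`, `-π/2` for `s < 0`, and `0` for `s = 0` (then the density
is constant on `[-π/2, π/2]`). -/
def mode (a s : ℝ) : ℝ :=
  if a = 1 then Real.sign s * (Real.pi / 2) else Real.arctan (beta a s)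

/-- `τ = √((a - 1) (1 + β²))`. -/
def tau (a s : ℝ) : ℝ := √((a - 1) * (1 + beta a s ^ 2))

/-- The uniform probability law on the interval `[l, r]`. -/
def uniformLaw (l r : ℝ) : Measure ℝ := ProbabilityTheory.cond volume (Set.Icc l r)

/-- The test that selects the branch of the algorithm: normal envelope if it holds, uniform
envelope otherwise. -/
def UseNormal (a s : ℝ) : Prop := √(2 / Real.pi) ≤ tau a s

open Classical in
/-- The law of the first variate drawn in an iteration: a standard Gaussian `N` in the normal
branch, and `Y` uniform on `[-π/2, π/2]` in the uniform branch. -/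
def variateLaw (a s : ℝ) : Measure ℝ :=
  if UseNormal a s then gaussianReal 0 1 else uniformLaw (-(Real.pi / 2)) (Real.pi / 2)

open Classical in
/-- The candidate `Y` computed in an iteration from the first variate `z`: it is `m + z / τ` in the
normal branch, and `z` itself in the uniform branch. -/
def candidate (a s z : ℝ) : ℝ :=
  if UseNormal a s then mode a s + z / tau a s else z

open Classical in
/-- The halting test of the `repeat … until` loop for the candidate `y` and the uniform variate
`u`: `u h(m) exp(-τ² (y - m)² / 2) ≤ h(y)` in the normal branch, and `u ≤ h(y) / h(m)` in the
uniform branch. -/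
def Accepts (a s y u : ℝ) : Prop :=
  if UseNormal a s then
    u * density a s (mode a s) * Real.exp (-(tau a s) ^ 2 * ((y - mode a s) ^ 2 / 2))
      ≤ density a s y
  else u ≤ density a s y / density a s (mode a s)

/-- `Z` and `U` are the random variates consumed by the algorithm (iteration number `i + 1` draws
`Z i`, then `U i`): the pairs `(Z i, U i)` are independent over `i`, and in each pair `Z i` has the
law prescribed by the branch and is independent of `U i`, which is uniform on `[0, 1]`. -/
structure IsInput {Ω : Type*} [MeasurableSpace Ω] (P : Measure Ω) (a s : ℝ)
    (Z U : ℕ → Ω → ℝ) : Prop where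
  hasLaw : ∀ i, HasLaw (fun ω => (Z i ω, U i ω)) ((variateLaw a s).prod (uniformLaw 0 1)) P
  indep : iIndepFun (fun i ω => (Z i ω, U i ω)) P

/-- The number of iterations of the loop when it is fed with the variates `z` and `u`: the least
`i + 1` such that iteration number `i + 1` passes the halting test, and `∞` if there is none. -/
def iterations (a s : ℝ) (z u : ℕ → ℝ) : ℝ≥0∞ :=
  ⨅ (i : ℕ) (_ : Accepts a s (candidate a s (z i)) (u i)), ((i + 1 : ℕ) : ℝ≥0∞)

end PearsonIV

end

/-! ### Parameters and the density -/

namespace PearsonIV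

/-! Write T = tan m. Then s = 2(a-1)T and τ² = (a-1)(1+T²), so log(h(y)/h(m)) is 2(a-1) times T(y-m)
+ log cos y - log cos m. As T² ≤ 1, this last expression is at most -(1+T²)(y-m)²/4, only half the
true curvature at m; that is the Gaussian envelope (`tan_mul_add_log_cos_le`).

The number of iterations is geometric, with mean at most 1/p for the acceptance probability p
(`lintegral_iterations_le`). The bound |T| ≤ 1/4 gives a parabola below h, h(m+x) ≥ h(m)(1 - 2Mx²)
with M = max(a-1, 1) (`mode_mul_le_density`). Integrating it where it is nonnegative bounds p from
below in each branch: the Gaussian weight cancels the envelope in one, the uniform weight is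
constant in the other. The threshold √(2/π) on τ then yields p² ≥ 1/(2π+π²). -/

lemma normConst_pos {a : ℝ} (ha : 1 ≤ a) (s : ℝ) : 0 < normConst a s := by
  have h : Complex.Gamma ((a : ℂ) - Complex.I * (s : ℂ) / 2) ≠ 0 := by
    apply Complex.Gamma_ne_zero_of_re_pos
    simp
    linarith
  unfold normConst
  have h1 := Real.Gamma_pos_of_pos (show 0 < a by linarith)
  have h2 := Real.Gamma_pos_of_pos (show 0 < a - 1 / 2 by linarith)
  have h3 := Real.Gamma_pos_of_pos (show (0 : ℝ) < 1 / 2 by norm_num)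
  positivity

/-- The parameters expressed through the mode, whenever the mode is small. -/
lemma mode_spec {a s : ℝ} (ha : 1 ≤ a)
    (hm : |mode a s| ≤ Real.arctan (3 / (4 * Real.pi))) :
    |mode a s| ≤ 1 / 4 ∧ |Real.tan (mode a s)| ≤ 1 / 4 ∧
      s = 2 * (a - 1) * Real.tan (mode a s) ∧
      tau a s ^ 2 = (a - 1) * (1 + Real.tan (mode a s) ^ 2) := by
  have hpi := Real.pi_gt_three
  have hq : 3 / (4 * Real.pi) ≤ 1 / 4 := by
    rw [div_le_iff₀ (by positivity)]; linarith
  have hq0 : 0 ≤ 3 / (4 * Real.pi) := by positivity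
  have htau : tau a s ^ 2 = (a - 1) * (1 + beta a s ^ 2) :=
    Real.sq_sqrt (mul_nonneg (by linarith) (by positivity))
  have harc : Real.arctan (3 / (4 * Real.pi)) ≤ 1 / 4 := by
    refine le_trans ?_ hq
    have h := Real.le_tan (Real.arctan_nonneg.2 hq0) (Real.arctan_lt_pi_div_two _)
    rwa [Real.tan_arctan] at h
  by_cases h1 : a = 1
  -- For a = 1 a nonzero s would put the mode at ±π/2, beyond the allowed range.
  · have hs : s = 0 := by
      by_contra hs
      have : |mode a s| = Real.pi / 2 := by
        rw [mode, if_pos h1, abs_mul]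
        rcases lt_or_gt_of_ne hs with h | h
        · rw [Real.sign_of_neg h, abs_of_pos (by positivity : 0 < Real.pi / 2)]; simp
        · rw [Real.sign_of_pos h, abs_of_pos (by positivity : 0 < Real.pi / 2)]; simp
      linarith
    have hmode : mode a s = 0 := by simp [mode, h1, hs]
    rw [htau, hmode, h1, hs]
    norm_num
  · have hmode : mode a s = Real.arctan (beta a s) := by rw [mode, if_neg h1]
    have ht : Real.tan (mode a s) = beta a s := by rw [hmode, Real.tan_arctan]
    have hk : a - 1 ≠ 0 := sub_ne_zero.2 h1
    refine ⟨hm.trans harc, ?_, ?_, by rw [ht, htau]⟩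
    · rw [ht]
      refine le_trans ?_ hq
      rw [hmode] at hm
      rw [abs_le] at hm ⊢
      rw [← Real.arctan_neg] at hm
      exact ⟨Real.arctan_strictMono.le_iff_le.1 hm.1, Real.arctan_strictMono.le_iff_le.1 hm.2⟩
    · rw [ht, beta]; field_simp

lemma density_eq_of_abs_lt {a s y : ℝ} (hy : |y| < Real.pi / 2) :
    density a s y =
      normConst a s * Real.exp (s * y + 2 * (a - 1) * Real.log (Real.cos y)) := by
  have hc : 0 < Real.cos y := Real.cos_pos_of_mem_Ioo (abs_lt.1 hy)
  rw [density, if_pos hy.le, Real.exp_add, Real.rpow_def_of_pos (by positivity), Real.log_pow,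
    mul_assoc]
  congr 3
  push_cast; ring

lemma density_pos {a s y : ℝ} (ha : 1 ≤ a) (hy : |y| < Real.pi / 2) : 0 < density a s y := by
  rw [density_eq_of_abs_lt hy]
  exact mul_pos (normConst_pos ha s) (Real.exp_pos _)

/-! ### The Gaussian envelope -/

lemma monotoneOn_tan_sub_id :
    MonotoneOn (fun y => Real.tan y - y) (Set.Ioo (-(Real.pi / 2)) (Real.pi / 2)) := by
  have hd : ∀ y ∈ Set.Ioo (-(Real.pi / 2)) (Real.pi / 2),
      HasDerivAt (fun y => Real.tan y - y) (1 / Real.cos y ^ 2 - 1) y := fun y hy =>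
    (Real.hasDerivAt_tan (Real.cos_pos_of_mem_Ioo hy).ne').sub (hasDerivAt_id y)
  refine monotoneOn_of_deriv_nonneg (convex_Ioo _ _)
    (fun y hy => (hd y hy).continuousAt.continuousWithinAt)
    (fun y hy => (hd y (interior_subset hy)).differentiableAt.differentiableWithinAt)
    (fun y hy => ?_)
  have hy' := interior_subset hy
  have hc := Real.cos_pos_of_mem_Ioo hy'
  rw [(hd y hy').deriv, sub_nonneg, le_div_iff₀ (by positivity)]
  nlinarith [Real.cos_le_one y]

/-- The logarithm of the cosine has a quadratic upper bound with half of its curvature at `m`. -/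
lemma tan_mul_add_log_cos_le {m y : ℝ} (hm : |m| < Real.pi / 2) (hy : |y| < Real.pi / 2)
    (ht : |Real.tan m| ≤ 1) :
    Real.tan m * (y - m) + Real.log (Real.cos y) +
      (1 + Real.tan m ^ 2) * (y - m) ^ 2 / 4 ≤ Real.log (Real.cos m) := by
  set T := Real.tan m
  -- This makes (1+T²)/2 ≤ 1, while tan z - T changes at least as fast as z - m. Hence f' ≥ 0 to the
  -- left of m and f' ≤ 0 to its right.
  have hT : T ^ 2 ≤ 1 := by rw [← sq_abs]; nlinarith [abs_nonneg T]
  let f : ℝ → ℝ := fun y => T * (y - m) + Real.log (Real.cos y) + (1 + T ^ 2) * (y - m) ^ 2 / 4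
  have hd : ∀ y ∈ Set.Ioo (-(Real.pi / 2)) (Real.pi / 2),
      HasDerivAt f (T - Real.tan y + (1 + T ^ 2) * (y - m) / 2) y := by
    intro y hy
    have h1 := (hasDerivAt_id' y).sub_const m
    have h2 := (Real.hasDerivAt_cos y).log (Real.cos_pos_of_mem_Ioo hy).ne'
    refine (((h1.const_mul T).add h2).add
      (((h1.pow 2).const_mul (1 + T ^ 2)).div_const 4)).congr_deriv ?_
    rw [Real.tan_eq_sin_div_cos]
    push_cast
    ring
  have hm' := abs_lt.1 hm
  have hy' := abs_lt.1 hy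
  have key : f y ≤ f m := by
    rcases le_total m y with h | h
    · have hsub : Set.Icc m y ⊆ Set.Ioo (-(Real.pi / 2)) (Real.pi / 2) := fun z hz =>
        ⟨hm'.1.trans_le hz.1, hz.2.trans_lt hy'.2⟩
      refine antitoneOn_of_deriv_nonpos (convex_Icc m y)
        (fun z hz => (hd z (hsub hz)).continuousAt.continuousWithinAt)
        (fun z hz => (hd z (hsub (interior_subset hz))).differentiableAt.differentiableWithinAt)
        (fun z hz => ?_) (Set.left_mem_Icc.2 h) (Set.right_mem_Icc.2 h) h
      have hz' := interior_subset hz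
      rw [(hd z (hsub hz')).deriv]
      have := monotoneOn_tan_sub_id hm' (hsub hz') hz'.1
      simp only at this
      nlinarith [mul_nonneg (sub_nonneg.2 hT) (sub_nonneg.2 hz'.1)]
    · have hsub : Set.Icc y m ⊆ Set.Ioo (-(Real.pi / 2)) (Real.pi / 2) := fun z hz =>
        ⟨hy'.1.trans_le hz.1, hz.2.trans_lt hm'.2⟩
      refine monotoneOn_of_deriv_nonneg (convex_Icc y m)
        (fun z hz => (hd z (hsub hz)).continuousAt.continuousWithinAt)
        (fun z hz => (hd z (hsub (interior_subset hz))).differentiableAt.differentiableWithinAt)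
        (fun z hz => ?_) (Set.left_mem_Icc.2 h) (Set.right_mem_Icc.2 h) h
      have hz' := interior_subset hz
      rw [(hd z (hsub hz')).deriv]
      have := monotoneOn_tan_sub_id (hsub hz') hm' hz'.2
      simp only at this
      nlinarith [mul_nonneg (sub_nonneg.2 hT) (sub_nonneg.2 hz'.2)]
  simpa [f] using key

theorem density_le_mode_mul_exp {a s : ℝ} (ha : 1 ≤ a)
    (hm : |mode a s| ≤ Real.arctan (3 / (4 * Real.pi))) (y : ℝ) :
    density a s y ≤ density a s (mode a s) *
      Real.exp (-(tau a s) ^ 2 * ((y - mode a s) ^ 2 / 2)) := by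
  obtain ⟨hm4, hT, hs, htau⟩ := mode_spec ha hm
  have hpi := Real.pi_gt_three
  set m := mode a s
  have hmpi : |m| < Real.pi / 2 := by linarith
  have hdm := density_pos (s := s) ha hmpi
  rcases lt_trichotomy |y| (Real.pi / 2) with hy | hy | hy
  · rw [density_eq_of_abs_lt hy, density_eq_of_abs_lt hmpi, mul_assoc (normConst a s), ← Real.exp_add]
    refine mul_le_mul_of_nonneg_left (Real.exp_le_exp.2 ?_) (normConst_pos ha s).le
    have h := tan_mul_add_log_cos_le hmpi hy (by linarith)
    rw [neg_mul, htau]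
    have h2 := mul_le_mul_of_nonneg_left h (show 0 ≤ 2 * (a - 1) by linarith)
    have e : s * (y - m) = 2 * (a - 1) * (Real.tan m * (y - m)) := by
      linear_combination (y - m) * hs
    nlinarith
  · have hc : Real.cos y = 0 := by rw [← Real.cos_abs, hy, Real.cos_pi_div_two]
    -- At |y| = π/2 the power is 0^(a-1): it is 1 for a = 1, where h is constant on the interval and
    -- τ = 0, and 0 otherwise.
    by_cases h1 : a = 1
    · have hs0 : s = 0 := by rw [hs, h1]; ring
      have ht0 : tau a s ^ 2 = 0 := by rw [htau, h1]; ring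
      rw [neg_mul, ht0]
      simp only [density, hy, hmpi.le, hs0, h1]
      simp
    · rw [density, if_pos hy.le, hc]
      rw [zero_pow two_ne_zero, Real.zero_rpow (sub_ne_zero.2 h1), mul_zero]
      positivity
  · rw [density, if_neg hy.not_ge]
    positivity

/-! ### A parabola below the density -/

/-- The linear terms of the two factors cancel, since x = 0 is critical. The first is at least 1 +
Tx, the second at least 1 - Tx - (9/16)x², where 9/16 = 1/2 + 1/16 collects the errors of cos x and
T sin x. -/
lemma one_sub_sq_le_exp_mul_cos_sub {T x : ℝ} (hT : |T| ≤ 1 / 4) (hx : |x| ≤ 1) :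
    1 - x ^ 2 ≤ Real.exp (T * x) * (Real.cos x - T * Real.sin x) := by
  have hsin : T * Real.sin x ≤ T * x + x ^ 2 / 16 := by
    have h : |Real.sin x - x| ≤ |x| ^ 3 / 4 := by
      have aux : ∀ z : ℝ, 0 < z → |Real.sin z - z| ≤ z ^ 3 / 4 := fun z h0 => by
        have := Real.sin_gt_sub_cube h0
        have := Real.sin_lt h0
        rw [abs_le]; constructor <;> linarith [pow_pos h0 3]
      rcases lt_trichotomy x 0 with h | h | h
      · have := aux (-x) (by linarith)
        rw [abs_of_neg h]
        rw [Real.sin_neg, ← abs_neg] at this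
        convert this using 2; ring
      · simp [h]
      · rw [abs_of_pos h]
        exact aux x h
    have h2 : |T * (Real.sin x - x)| ≤ x ^ 2 / 16 := by
      rw [abs_mul, ← sq_abs x]
      have h3 : |x| ^ 3 / 4 ≤ |x| ^ 2 / 4 := by
        nlinarith [mul_nonneg (sq_nonneg |x|) (sub_nonneg.2 hx)]
      calc |T| * |Real.sin x - x| ≤ 1 / 4 * (|x| ^ 2 / 4) :=
            mul_le_mul hT (h.trans h3) (abs_nonneg _) (by norm_num)
        _ = _ := by ring
    nlinarith [le_abs_self (T * (Real.sin x - x))]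
  have hcos := Real.one_sub_sq_div_two_le_cos (x := x)
  have hTx : |T * x| ≤ 1 / 4 := by
    rw [abs_mul]; nlinarith [abs_nonneg T, abs_nonneg x]
  have hTx2 : (T * x) ^ 2 ≤ x ^ 2 / 16 := by
    have : T ^ 2 ≤ 1 / 16 := by rw [← sq_abs]; nlinarith [abs_nonneg T]
    nlinarith [mul_nonneg (sub_nonneg.2 this) (sq_nonneg x)]
  have hx2 : x ^ 2 ≤ 1 := by rw [← sq_abs]; nlinarith [abs_nonneg x]
  obtain ⟨hl, hu⟩ := abs_le.1 hTx
  have hE := Real.add_one_le_exp (T * x)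
  have hF : 1 - T * x - 9 / 16 * x ^ 2 ≤ Real.cos x - T * Real.sin x := by linarith
  calc 1 - x ^ 2 ≤ (T * x + 1) * (1 - T * x - 9 / 16 * x ^ 2) := by
        nlinarith [mul_nonneg (sub_nonneg.2 hu) (sq_nonneg x)]
    _ ≤ _ := mul_le_mul hE hF (by nlinarith) (Real.exp_pos _).le

/-- Bernoulli's inequality for k ≥ 1; for k ≤ 1 the power only raises a base in [0,1]. -/
lemma one_sub_max_mul_le_rpow {k v : ℝ} (hv : 0 ≤ v) (hv1 : v ≤ 1) :
    1 - max k 1 * v ≤ (1 - v) ^ k := by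
  rcases le_total k 1 with h | h
  · rw [max_eq_right h, one_mul]
    exact Real.self_le_rpow_of_le_one (by linarith) (by linarith) h
  · rw [max_eq_left h]
    have := one_add_mul_self_le_rpow_one_add (s := -v) (by linarith) h
    rw [← sub_eq_add_neg] at this
    linarith

/-- The ratio h(m+x)/h(m) is the (a-1)-th power of (e^{Tx}(cos x - T sin x))², which is at least
(1-x²)² ≥ 1 - 2x². -/
lemma mode_mul_le_density {a s x : ℝ} (ha : 1 ≤ a)
    (hm : |mode a s| ≤ Real.arctan (3 / (4 * Real.pi))) (hx : 2 * x ^ 2 ≤ 1) :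
    density a s (mode a s) * (1 - max (a - 1) 1 * (2 * x ^ 2)) ≤ density a s (mode a s + x) := by
  obtain ⟨hm4, hT, hs, -⟩ := mode_spec ha hm
  have hpi := Real.pi_gt_three
  set m := mode a s
  have hmpi : |m| < Real.pi / 2 := by linarith
  have hx1 : |x| ≤ 1 := by
    rw [abs_le]; constructor <;> nlinarith
  have hmx : |m + x| < Real.pi / 2 := by linarith [abs_add_le m x]
  have hcm : 0 < Real.cos m := Real.cos_pos_of_mem_Ioo (abs_lt.1 hmpi)
  have hF := one_sub_sq_le_exp_mul_cos_sub hT hx1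
  have hratio : density a s (m + x) = density a s m *
      ((Real.exp (Real.tan m * x) * (Real.cos x - Real.tan m * Real.sin x)) ^ 2) ^ (a - 1) := by
    have hcos : Real.cos (m + x) = Real.cos m * (Real.cos x - Real.tan m * Real.sin x) := by
      rw [Real.cos_add, Real.tan_eq_sin_div_cos]; field_simp
    rw [density, density, if_pos hmx.le, if_pos hmpi.le, hcos, mul_pow, mul_pow,
      Real.mul_rpow (sq_nonneg _) (sq_nonneg _), Real.mul_rpow (sq_nonneg _) (sq_nonneg _),
      ← Real.exp_nat_mul, ← Real.exp_mul, mul_add s, Real.exp_add]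
    have e : s * x = ((2 : ℕ) : ℝ) * (Real.tan m * x) * (a - 1) := by
      push_cast; linear_combination x * hs
    rw [e]; ring
  rw [hratio]
  refine mul_le_mul_of_nonneg_left ?_ (density_pos ha hmpi).le
  refine (one_sub_max_mul_le_rpow (by positivity) hx).trans ?_
  refine Real.rpow_le_rpow (by linarith) ?_ (by linarith)
  nlinarith [sq_nonneg x]

/-! ### Expected iterations and the acceptance probability -/

lemma measurable_density (a s : ℝ) : Measurable (density a s) := by
  unfold density
  refine Measurable.ite ?_ ?_ measurable_const
  · exact (isClosed_le continuous_abs continuous_const).measurableSet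
  · fun_prop

lemma measurableSet_accepts (a s : ℝ) :
    MeasurableSet {p : ℝ × ℝ | Accepts a s (candidate a s p.1) p.2} := by
  have hd := measurable_density a s
  by_cases h : UseNormal a s
  · simp only [Accepts, candidate, if_pos h]
    exact measurableSet_le (by fun_prop) (by fun_prop)
  · simp only [Accepts, candidate, if_neg h]
    exact measurableSet_le (by fun_prop) (by fun_prop)

-- The sum counts the n for which the first n iterations all fail, so its expectation is a sum of
-- tail probabilities.
open Classical in
lemma iterations_le_tsum (a s : ℝ) (z u : ℕ → ℝ) :
    iterations a s z u ≤ ∑' n : ℕ, if ∀ i ∈ Finset.range n,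
      ¬ Accepts a s (candidate a s (z i)) (u i) then (1 : ℝ≥0∞) else 0 := by
  by_cases h : ∃ i, Accepts a s (candidate a s (z i)) (u i)
  · calc iterations a s z u ≤ ((Nat.find h + 1 : ℕ) : ℝ≥0∞) := 
        (iInf_le _ (Nat.find h)).trans (iInf_le _ (Nat.find_spec h))
      _ = ∑ n ∈ Finset.range (Nat.find h + 1), (1 : ℝ≥0∞) := by simp
      _ = ∑ n ∈ Finset.range (Nat.find h + 1), if ∀ i ∈ Finset.range n,
            ¬ Accepts a s (candidate a s (z i)) (u i) then (1 : ℝ≥0∞) else 0 := by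
          refine Finset.sum_congr rfl fun n hn => (if_pos fun i hi => Nat.find_min h ?_).symm
          rw [Finset.mem_range] at hn hi
          omega
      _ ≤ _ := ENNReal.sum_le_tsum _
  · push Not at h
    simp [h]

/-- The number of iterations is at most geometric in expectation. -/
lemma lintegral_iterations_le {Ω : Type*} [MeasurableSpace Ω] {P : Measure Ω}
    {a s : ℝ} {Z U : ℕ → Ω → ℝ} (h : IsInput P a s Z U)
    [IsProbabilityMeasure ((variateLaw a s).prod (uniformLaw 0 1))] :
    ∫⁻ ω, iterations a s (fun i => Z i ω) (fun i => U i ω) ∂P ≤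
      ((variateLaw a s).prod (uniformLaw 0 1)
        {p : ℝ × ℝ | Accepts a s (candidate a s p.1) p.2})⁻¹ := by
  classical
  set ν := (variateLaw a s).prod (uniformLaw 0 1)
  set A := {p : ℝ × ℝ | Accepts a s (candidate a s p.1) p.2} with hA
  have hAm : MeasurableSet A := measurableSet_accepts a s
  let B : ℕ → Set Ω := fun n => ⋂ i ∈ Finset.range n, (fun ω => (Z i ω, U i ω)) ⁻¹' Aᶜ
  have hBm : ∀ n, NullMeasurableSet (B n) P := fun n =>
    Finset.nullMeasurableSet_biInter _ fun i _ =>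
      (h.hasLaw i).aemeasurable.nullMeasurableSet_preimage hAm.compl
  have hB : ∀ n, P (B n) = (1 - ν A) ^ n := by
    intro n
    rw [(iIndepFun_iff_measure_inter_preimage_eq_mul.1 h.indep) (Finset.range n)
      (fun i _ => hAm.compl)]
    have : ∀ i, P ((fun ω => (Z i ω, U i ω)) ⁻¹' Aᶜ) = 1 - ν A := fun i => by
      rw [← Measure.map_apply_of_aemeasurable (h.hasLaw i).aemeasurable hAm.compl,
        (h.hasLaw i).map_eq, prob_compl_eq_one_sub hAm]
    simp only [this, Finset.prod_const, Finset.card_range]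
  calc ∫⁻ ω, iterations a s (fun i => Z i ω) (fun i => U i ω) ∂P
      ≤ ∫⁻ ω, ∑' n : ℕ, (B n).indicator (fun _ => 1) ω ∂P := by
        refine lintegral_mono fun ω => (iterations_le_tsum a s _ _).trans_eq ?_
        refine tsum_congr fun n => ?_
        simp [B, hA, Set.indicator_apply]
    _ = ∑' n : ℕ, (1 - ν A) ^ n := by
        rw [lintegral_tsum fun n => aemeasurable_const.indicator₀ (hBm n)]
        exact tsum_congr fun n => by 
          rw [← hB]; exact lintegral_indicator_one₀ (hBm n)
    _ = (ν A)⁻¹ := by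
        rw [ENNReal.tsum_geometric, ENNReal.sub_sub_cancel ENNReal.one_ne_top prob_le_one]

/-! ### Lower bounds for the acceptance probability -/

lemma ofReal_le_uniformLaw {q : ℝ} {S : Set ℝ} (hq : q ≤ 1)
    (hS : Set.Icc 0 q ⊆ S) : ENNReal.ofReal q ≤ uniformLaw 0 1 S := by
  rw [uniformLaw, cond_apply measurableSet_Icc]
  simp only [Real.volume_Icc, sub_zero, ENNReal.ofReal_one, inv_one, one_mul]
  calc ENNReal.ofReal q = volume (Set.Icc 0 q) := by simp
    _ ≤ _ := measure_mono (Set.subset_inter (Set.Icc_subset_Icc_right hq) hS)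

lemma isProbabilityMeasure_uniformLaw {l r : ℝ} (h : l < r) :
    IsProbabilityMeasure (uniformLaw l r) :=
  cond_isProbabilityMeasure_of_finite (by simp [h]) (by simp)

lemma integral_one_sub_mul_sq {K : ℝ} (hK : 0 < K) (m : ℝ) :
    ∫ y in (m - 1 / √K)..(m + 1 / √K), (1 - K * (y - m) ^ 2) = 4 / (3 * √K) := by
  rw [intervalIntegral.integral_comp_sub_right (fun x => 1 - K * x ^ 2) m]
  rw [intervalIntegral.integral_sub (by simp) (by apply Continuous.intervalIntegrable; fun_prop)]
  simp only [intervalIntegral.integral_const, intervalIntegral.integral_const_mul, integral_pow]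
  have h : 0 < √K := Real.sqrt_pos.2 hK
  have h2 : K = √K ^ 2 := (Real.sq_sqrt hK.le).symm
  generalize √K = r at *
  subst h2
  simp
  field_simp
  ring

lemma mul_sq_le_one_of_mem_Icc {K m y : ℝ} (hK : 0 < K)
    (hy : y ∈ Set.Icc (m - 1 / √K) (m + 1 / √K)) : K * (y - m) ^ 2 ≤ 1 := by
  have h1 : |y - m| ≤ 1 / √K := by
    rw [abs_le]; constructor <;> linarith [hy.1, hy.2]
  rw [← sq_abs]
  calc K * |y - m| ^ 2 ≤ K * (1 / √K) ^ 2 := by gcongr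
    _ = 1 := by rw [div_pow, Real.sq_sqrt hK.le]; field_simp

lemma lintegral_one_sub_mul_sq {K c : ℝ} (hK : 0 < K) (hc : 0 ≤ c) (m : ℝ) :
    ∫⁻ y in Set.Icc (m - 1 / √K) (m + 1 / √K), ENNReal.ofReal (c * (1 - K * (y - m) ^ 2)) =
      ENNReal.ofReal (c * (4 / (3 * √K))) := by
  have h : 0 < √K := Real.sqrt_pos.2 hK
  rw [← ofReal_integral_eq_lintegral_ofReal, integral_Icc_eq_integral_Ioc,
    ← intervalIntegral.integral_of_le, intervalIntegral.integral_const_mul,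
    integral_one_sub_mul_sq hK]
  · have : 0 < 1 / √K := by positivity
    linarith
  · exact (Continuous.continuousOn (by fun_prop)).integrableOn_Icc
  · filter_upwards [ae_restrict_mem measurableSet_Icc] with y hy
    exact mul_nonneg hc (by linarith [mul_sq_le_one_of_mem_Icc hK hy])

lemma isProbabilityMeasure_variateLaw (a s : ℝ) : IsProbabilityMeasure (variateLaw a s) := by
  unfold variateLaw
  split_ifs
  · infer_instance
  · exact isProbabilityMeasure_uniformLaw (by linarith [Real.pi_pos])

lemma le_acceptance_of_useNormal {a s : ℝ} (ha : 1 ≤ a)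
    (hm : |mode a s| ≤ Real.arctan (3 / (4 * Real.pi))) (hN : UseNormal a s) :
    ENNReal.ofReal ((√(2 * Real.pi))⁻¹ * (4 / (3 * √(2 * max (a - 1) 1 / tau a s ^ 2)))) ≤
      (variateLaw a s).prod (uniformLaw 0 1)
        {p : ℝ × ℝ | Accepts a s (candidate a s p.1) p.2} := by
  have hpi := Real.pi_gt_three
  have htau : 0 < tau a s := lt_of_lt_of_le (Real.sqrt_pos.2 (by positivity)) hN
  have hA := measurableSet_accepts a s
  have hD := density_pos (s := s) ha (show |mode a s| < Real.pi / 2 by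
    linarith [(mode_spec ha hm).1])
  have := isProbabilityMeasure_uniformLaw (zero_lt_one' ℝ)
  have hK1 : 1 ≤ max (a - 1) 1 := le_max_right _ _
  set M := max (a - 1) 1
  have hK : 0 < 2 * M / tau a s ^ 2 := by positivity
  rw [← lintegral_one_sub_mul_sq hK (by positivity) 0, variateLaw, if_pos hN,
    Measure.prod_apply hA, gaussianReal_of_var_ne_zero 0 one_ne_zero,
    lintegral_withDensity_eq_lintegral_mul _ (measurable_gaussianPDF 0 1)
      (measurable_measure_prodMk_left hA)]
  refine le_trans ?_ (setLIntegral_le_lintegral (Set.Icc (0 - 1 / √(2 * M / tau a s ^ 2))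
    (0 + 1 / √(2 * M / tau a s ^ 2))) _)
  refine setLIntegral_mono' measurableSet_Icc fun z hz => ?_
  have hz1 := mul_sq_le_one_of_mem_Icc hK hz
  rw [sub_zero] at hz1 ⊢
  have hx : 2 * M / tau a s ^ 2 * z ^ 2 = M * (2 * (z / tau a s) ^ 2) := by
    field_simp
  rw [hx] at hz1 ⊢
  have hlow := mode_mul_le_density ha hm (x := z / tau a s) (by
    nlinarith [sq_nonneg (z / tau a s)])
  have hup := density_le_mode_mul_exp ha hm (mode a s + z / tau a s)
  have he : -(tau a s) ^ 2 * ((mode a s + z / tau a s - mode a s) ^ 2 / 2) = -(z ^ 2 / 2) := by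
    rw [add_sub_cancel_left]; field_simp
  rw [he] at hup
  set q := 1 - M * (2 * (z / tau a s) ^ 2) with hq
  -- The parabola lies below h and h below the envelope, so this sufficient threshold for u does not
  -- exceed 1.
  have hq1 : Real.exp (z ^ 2 / 2) * q ≤ 1 := by
    have h1 : q ≤ Real.exp (-(z ^ 2 / 2)) := le_of_mul_le_mul_left (hlow.trans hup) hD
    calc Real.exp (z ^ 2 / 2) * q ≤ Real.exp (z ^ 2 / 2) * Real.exp (-(z ^ 2 / 2)) := by gcongr
      _ = 1 := by rw [← Real.exp_add]; simp
  have hu := ofReal_le_uniformLaw (S := Prod.mk z ⁻¹'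
      {p : ℝ × ℝ | Accepts a s (candidate a s p.1) p.2}) hq1 (fun u hu => by
    simp only [Set.mem_preimage, Set.mem_ofPred_eq, Accepts, candidate, if_pos hN]
    rw [he]
    refine le_trans ?_ hlow
    calc u * density a s (mode a s) * Real.exp (-(z ^ 2 / 2))
        ≤ (Real.exp (z ^ 2 / 2) * q) * density a s (mode a s) * Real.exp (-(z ^ 2 / 2)) := by
          gcongr
          exact hu.2
      _ = density a s (mode a s) * q * (Real.exp (z ^ 2 / 2) * Real.exp (-(z ^ 2 / 2))) := by
          ring
      _ = _ := by rw [← Real.exp_add]; simp)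
  refine le_trans (le_of_eq ?_) (mul_le_mul_right hu (gaussianPDF 0 1 z))
  rw [gaussianPDF, ← ENNReal.ofReal_mul (gaussianPDFReal_nonneg _ _ _), gaussianPDFReal]
  congr 1
  -- The Gaussian density cancels the factor e^{z²/2} of the threshold, leaving the bare parabola.
  have e : Real.exp (-(z ^ 2 / 2)) * Real.exp (z ^ 2 / 2) = 1 := by rw [← Real.exp_add]; simp
  simp only [NNReal.coe_one, mul_one, sub_zero, neg_div]
  linear_combination (-(√(2 * Real.pi))⁻¹ * q) * e

lemma le_acceptance_of_not_useNormal {a s : ℝ} (ha : 1 ≤ a)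
    (hm : |mode a s| ≤ Real.arctan (3 / (4 * Real.pi))) (hN : ¬ UseNormal a s) :
    ENNReal.ofReal (Real.pi⁻¹ * (4 / (3 * √(2 * max (a - 1) 1)))) ≤
      (variateLaw a s).prod (uniformLaw 0 1)
        {p : ℝ × ℝ | Accepts a s (candidate a s p.1) p.2} := by
  have hpi := Real.pi_gt_three
  have hA := measurableSet_accepts a s
  have hm4 := (mode_spec ha hm).1
  have hD := density_pos (s := s) ha (show |mode a s| < Real.pi / 2 by linarith)
  have := isProbabilityMeasure_uniformLaw (zero_lt_one' ℝ)
  have hK1 : 1 ≤ max (a - 1) 1 := le_max_right _ _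
  set M := max (a - 1) 1
  have hK : 0 < 2 * M := by positivity
  have hunif : uniformLaw (-(Real.pi / 2)) (Real.pi / 2) =
      (ENNReal.ofReal Real.pi)⁻¹ • volume.restrict (Set.Icc (-(Real.pi / 2)) (Real.pi / 2)) := by
    rw [uniformLaw, ProbabilityTheory.cond, Real.volume_Icc, sub_neg_eq_add, add_halves]
  -- The support of the parabola fits because |m| + 1 ≤ 5/4 < π/2.
  have hsub : Set.Icc (mode a s - 1 / √(2 * M)) (mode a s + 1 / √(2 * M)) ⊆
      Set.Icc (-(Real.pi / 2)) (Real.pi / 2) := by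
    have h1 : 1 / √(2 * M) ≤ 1 := by
      rw [div_le_one (Real.sqrt_pos.2 hK)]
      exact Real.one_le_sqrt.2 (by linarith)
    have h2 := abs_le.1 hm4
    exact Set.Icc_subset_Icc (by linarith) (by linarith)
  rw [ENNReal.ofReal_mul (by positivity), ← one_mul (4 / (3 * √(2 * M))),
    ← lintegral_one_sub_mul_sq hK zero_le_one (mode a s), variateLaw, if_neg hN,
    Measure.prod_apply hA, hunif, lintegral_smul_measure, smul_eq_mul,
    ENNReal.ofReal_inv_of_pos Real.pi_pos]
  refine mul_le_mul_right ?_ _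
  refine le_trans ?_ (lintegral_mono_set hsub)
  refine setLIntegral_mono' measurableSet_Icc fun y hy => ?_
  have hy1 := mul_sq_le_one_of_mem_Icc hK hy
  have hlow := mode_mul_le_density ha hm (x := y - mode a s) (by
    nlinarith [sq_nonneg (y - mode a s)])
  rw [add_sub_cancel] at hlow
  refine ofReal_le_uniformLaw ?_ fun u hu => ?_
  · have : 0 ≤ 2 * M * (y - mode a s) ^ 2 := by positivity
    linarith
  · simp only [Set.mem_preimage, Set.mem_ofPred_eq, Accepts, candidate, if_neg hN]
    rw [le_div_iff₀ hD]
    refine le_trans ?_ hlow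
    rw [mul_comm]
    gcongr
    linarith [hu.2]

/-! ### The numerical bound -/

lemma lintegral_iterations_le_sqrt {a s : ℝ} (ha : 1 ≤ a)
    (hm : |mode a s| ≤ Real.arctan (3 / (4 * Real.pi)))
    {Ω : Type*} [MeasurableSpace Ω] (P : Measure Ω) {Z U : ℕ → Ω → ℝ}
    (h : IsInput P a s Z U) :
    ∫⁻ ω, iterations a s (fun i => Z i ω) (fun i => U i ω) ∂P ≤
      ENNReal.ofReal (√(2 * Real.pi + Real.pi ^ 2)) := by
  have hpi := Real.pi_gt_three
  have hpi4 := Real.pi_lt_four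
  have := isProbabilityMeasure_uniformLaw (zero_lt_one' ℝ)
  have := isProbabilityMeasure_variateLaw a s
  refine (lintegral_iterations_le h).trans ?_
  have hS : 0 < √(2 * Real.pi + Real.pi ^ 2) := Real.sqrt_pos.2 (by positivity)
  rw [ENNReal.inv_le_iff_inv_le, ← ENNReal.ofReal_inv_of_pos hS]
  have htau := (mode_spec ha hm).2.2.2
  have hc : a - 1 ≤ tau a s ^ 2 := by
    rw [htau]; nlinarith [mul_nonneg (sub_nonneg.2 ha) (sq_nonneg (Real.tan (mode a s)))]
  have h2pi : 0 < 2 / Real.pi := by positivity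
  by_cases hN : UseNormal a s
  · refine le_trans (ENNReal.ofReal_le_ofReal ?_) (le_acceptance_of_useNormal ha hm hN)
    have ht : 2 / Real.pi ≤ tau a s ^ 2 := (Real.sqrt_le_left (Real.sqrt_nonneg _)).1 hN
    have ht0 : 0 < tau a s ^ 2 := h2pi.trans_le ht
    have hM : 0 < max (a - 1) 1 := lt_max_of_lt_right one_pos
    refine (sq_le_sq₀ (by positivity) (by positivity)).1 ?_
    rw [inv_pow, mul_pow, inv_pow, div_pow, mul_pow, Real.sq_sqrt (by positivity),
      Real.sq_sqrt (by positivity), Real.sq_sqrt (by positivity)]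
    -- This is p² ≥ 1/(2π+π²) after clearing denominators. It uses τ² ≥ a-1 if the maximum is a-1,
    -- and τ² ≥ 2/π if it is 1, when 8 + 16/π ≥ 9 suffices.
    have key : 9 * max (a - 1) 1 ≤ tau a s ^ 2 * (4 * (2 + Real.pi)) := by
      rw [div_le_iff₀ Real.pi_pos] at ht
      rcases max_cases (a - 1) 1 with ⟨e, -⟩ | ⟨e, -⟩ <;> rw [e] <;> nlinarith
    rw [inv_eq_one_div, div_le_iff₀ (by positivity)]
    field_simp
    nlinarith
  · refine le_trans (ENNReal.ofReal_le_ofReal ?_) (le_acceptance_of_not_useNormal ha hm hN)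
    have ht : tau a s ^ 2 < 2 / Real.pi := Real.lt_sqrt (Real.sqrt_nonneg _) |>.1 (not_le.1 hN)
    have h1 : 2 / Real.pi ≤ 1 := by rw [div_le_one Real.pi_pos]; linarith
    -- Here a-1 ≤ τ² < 2/π ≤ 1, so M = 1 and the claim reduces to 9π ≤ 8(2+π).
    rw [max_eq_right (by linarith)]
    refine (sq_le_sq₀ (by positivity) (by positivity)).1 ?_
    rw [inv_pow, mul_pow, inv_pow, div_pow, mul_pow, Real.sq_sqrt (by positivity),
      Real.sq_sqrt (by positivity)]
    rw [inv_eq_one_div, div_le_iff₀ (by positivity)]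
    field_simp
    nlinarith

end PearsonIV

theorem mainTheorem3 :
    (∀ a s : ℝ, 1 ≤ a → |PearsonIV.mode a s| ≤ Real.arctan (3 / (4 * Real.pi)) →
      (∀ y : ℝ, PearsonIV.density a s y ≤
        PearsonIV.density a s (PearsonIV.mode a s) *
          Real.exp (-(PearsonIV.tau a s) ^ 2 * ((y - PearsonIV.mode a s) ^ 2 / 2))) ∧
      (∀ {Ω : Type*} [MeasurableSpace Ω] (P : MeasureTheory.Measure Ω)
        [MeasureTheory.IsProbabilityMeasure P] (Z U : ℕ → Ω → ℝ),
        PearsonIV.IsInput P a s Z U →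
        ∫⁻ ω, PearsonIV.iterations a s (fun i => Z i ω) (fun i => U i ω) ∂P ≤
          ENNReal.ofReal (√(2 * Real.pi + Real.pi ^ 2)))) ∧
    |√(2 * Real.pi + Real.pi ^ 2) - 4.02| < 0.005 := by
  refine ⟨fun a s ha hm => ⟨PearsonIV.density_le_mode_mul_exp ha hm, fun P _ Z U h =>
    PearsonIV.lintegral_iterations_le_sqrt ha hm P h⟩, ?_⟩
  have h1 := Real.pi_gt_d4
  have h2 := Real.pi_lt_d4
  have h3 : 4.015 < √(2 * Real.pi + Real.pi ^ 2) := Real.lt_sqrt_of_sq_lt (by nlinarith)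
  have h4 : √(2 * Real.pi + Real.pi ^ 2) < 4.025 := by
    rw [Real.sqrt_lt' (by norm_num)]; nlinarith
  rw [abs_lt]
  constructor <;> linarith
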